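/- Let $\mathbb{F}_q$ be the finite field with $q\equiv 5 \pmod 6$ elements and put $L=\frac{q+1}{6}$. For a polynomial $h$ of degree $m\ge 2$ let $G(h)$ be the number of $t\in\mathbb{F}_q$ such that $h(x)+t$ has exactly $m$ distinct roots in $\mathbb{F}_q$; $h$ is called good if it is constant on each of at least one (pairwise disjoint) $m$-subsets of $\mathbb{F}_q$. For a linear code $\mathcal C\subseteq\mathbb{F}_q^n$, a set $R$ of coordinates is a local repair group for $(r,\delta)$ if $|R|\le r+\delta-1$ and the restriction $\mathcal C_R$ is either zero or of minimum distance at least $\delta$; $\mathcal C$ is an $(r,\delta)$-LRC if every coordinate lies in a local repair group. Let $a_1\in\mathbb{F}_q$ be a nonzero square (such $a_1$ exist) and $f(x)=x^3+a_1x$. Then $G(f)=L$, and there are $L$ pairwise disjoint $3$-subsets $A_1,\dots,A_L$ of $\mathbb{F}_q$, on each of which $f$ is constant. For any such sets $A_i=\{a_{i,1},a_{i,2},a_{i,3}\}$ the complement $\mathbb{F}_q\setminus\bigcup_i A_i$ is non-empty. Let $x_0$ be any element of it, and put $g(x)=f(x)-f(x_0)$, $g_1(x)=x-x_0$ and $g_2(x)=g(x)/(x-x_0)$.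 Then $g=g_2g_1$ is a good polynomial of degree $3$ with $\deg g_1=1$, $\deg g_2=2$ and $G(g)=G(f)$, it is constant on each $A_i$, and $g(a)\neq 0$ for all $a\in\bigcup_iA_i$. Let $2\le k\le \frac{q+1}{3}+1$, and for $i\in\{0,1\}$ let $\xi(i)=\lfloor\frac{k+1}{2}\rfloor$ if $i<((k+1)\bmod 2)$ and $\xi(i)=\lfloor\frac{k+1}{2}\rfloor-1$ otherwise. For $\boldsymbol I=(I_0;\,I_{i,j},\ i\in\{0,1\},\ 1\le j\le\xi(i))$ with entries in $\mathbb{F}_q$ let $$F_{\boldsymbol I}(x)=I_0g_1(x)+\sum_{i=0}^{1}\sum_{j=1}^{\xi(i)}I_{i,j}x^ig(x)^j .$$ Then the code (Construction B with $r=\delta=2$) $$\mathcal C=\{(I_0,I_0,\ F_{\boldsymbol I}(a_{i,j}),\ 1\le i\le L,\ 1\le j\le 3)\ :\ \boldsymbol I\}$$ is a linear $(2,2)$-LRC of length $n=\frac{q+1}{2}+2$, dimension $k$ and minimum distance $$d=n-k-\left\lceil\frac{k+1}{2}\right\rceil+2 .$$ It has $L+1$ pairwise disjoint local repair groups, $L$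 of size $3$ and one of size $2$, and it is distance-optimal: its minimum distance is the largest among all $(2,2)$-LRCs over $\mathbb{F}_q$ of the same length $n$ and dimension $k$ that have $L$ local repair groups of size $3$ and one of size $2$, all pairwise disjoint. -/

import Mathlib

open Polynomial

namespace LRC

section Codes

variable {F : Type*} [Field F] [DecidableEq F] {ι : Type*} [Fintype ι]

/-- The minimum distance of a linear code: the least Hamming weight of a nonzero codeword
(with the value `0` for the zero code, which has no nonzero codeword). -/
noncomputable def minDist (C : Submodule F (ι → F)) : ℕ :=
  sInf {w : ℕ | ∃ c ∈ C, c ≠ 0 ∧ hammingNorm c = w}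

/-- The restriction of a code to the coordinates in `R`. -/
def punctured (C : Submodule F (ι → F)) (R : Finset ι) : Submodule F (R → F) :=
  C.map (LinearMap.funLeft F F (Subtype.val : R → ι))

/-- `R` is a local repair group of `C` for the parameters `(r, δ)`. -/
def IsRepairGroup (r δ : ℕ) (C : Submodule F (ι → F)) (R : Finset ι) : Prop :=
  R.card ≤ r + δ - 1 ∧ (punctured C R = ⊥ ∨ δ ≤ minDist (punctured C R))

/-- `C` is a locally repairable code with `(r, δ)`-locality. -/
def IsLRC (r δ : ℕ) (C : Submodule F (ι → F)) : Prop :=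
  ∀ i : ι, ∃ R : Finset ι, i ∈ R ∧ IsRepairGroup r δ C R

/-- `C` has `L + 1` pairwise disjoint local repair groups, `L` of them of size `r + δ - 1` and
one of size `s`. -/
def HasRepairProfile (r δ L s : ℕ) (C : Submodule F (ι → F)) : Prop :=
  ∃ (A : Fin L → Finset ι) (B : Finset ι),
    (∀ i, IsRepairGroup r δ C (A i) ∧ (A i).card = r + δ - 1) ∧
    (IsRepairGroup r δ C B ∧ B.card = s) ∧
    (∀ i j, i ≠ j → Disjoint (A i) (A j)) ∧ (∀ i, Disjoint (A i) B)

/-- Distance-optimality: `C` is an `(r, δ)`-LRC with `L` repair groups of size `r + δ - 1` and one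
of size `s`, pairwise disjoint, and its minimum distance is the largest possible among all
`(r, δ)`-LRCs over `F` of the same length and dimension having such repair groups. -/
def IsDistanceOptimal (r δ L s : ℕ) (C : Submodule F (ι → F)) : Prop :=
  IsLRC r δ C ∧ HasRepairProfile r δ L s C ∧
    ∀ C' : Submodule F (Fin (Fintype.card ι) → F),
      Module.finrank F C' = Module.finrank F C → IsLRC r δ C' → HasRepairProfile r δ L s C' →
        minDist C' ≤ minDist C

end Codes

section GoodPolynomials

variable {F : Type*} [Field F]

/-- The row `a i` enumerates an `m`-subset `A_i` of `F`, the sets `A_i` are pairwise disjoint, and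
`f` is constant on each `A_i`. -/
def IsConstantOnBlocks {L m : ℕ} (f : F[X]) (a : Fin L → Fin m → F) : Prop :=
  (∀ i, Function.Injective (a i)) ∧
  (∀ i i', i ≠ i' → Disjoint (Set.range (a i)) (Set.range (a i'))) ∧
  (∀ i j j', f.eval (a i j) = f.eval (a i j'))

/-- A good polynomial: its degree `m` is at least `2`, and it is constant on each of `L ≥ 1`
pairwise disjoint `m`-subsets of `F`. -/
def IsGood (g : F[X]) : Prop :=
  2 ≤ g.natDegree ∧ ∃ (L : ℕ) (a : Fin L → Fin g.natDegree → F), 1 ≤ L ∧ IsConstantOnBlocks g a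

/-- `N_f(i)`: the number of `t` such that `f + t` has exactly `i` distinct roots in `F`. -/
noncomputable def rootCount (f : F[X]) (i : ℕ) : ℕ :=
  {t : F | {x : F | (f + C t).eval x = 0}.ncard = i}.ncard

/-- `G(f) = N_f(deg f)`. -/
noncomputable def goodness (f : F[X]) : ℕ := rootCount f f.natDegree

end GoodPolynomials

section ConstructionB

variable {F : Type*} [Field F]

/-- The requirements of Construction B on the polynomial `g = g₂ g₁` and on the pairwise disjoint
sets `A_i = {a i j}` of size `r + δ - 1`. -/
def IsConstructionBData (r δ : ℕ) {L : ℕ} (g g₁ g₂ : F[X]) (a : Fin L → Fin (r + δ - 1) → F) :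
    Prop :=
  IsGood g ∧ g = g₂ * g₁ ∧ g.natDegree = r + δ - 1 ∧ g₁.natDegree = r - 1 ∧ g₂.natDegree = δ ∧
    IsConstantOnBlocks g a ∧ ∀ i j, g.eval (a i j) ≠ 0

/-- The number `ξ(i)`, where `k' = k + v` with `v = r - 1`. -/
def xi (r k i : ℕ) : ℕ :=
  if i < (k + (r - 1)) % r then (k + (r - 1)) / r else (k + (r - 1)) / r - 1

/-- Information vectors `I = (I_0; I_{i,j} : 0 ≤ i < r, 1 ≤ j ≤ ξ(i))`. The entry `I_{i,j}` is
stored as `I.2 i (j - 1)`, since `Fin` starts at `0`. -/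
abbrev Info (F : Type*) (r k : ℕ) : Type _ := F × ((i : Fin r) → Fin (xi r k i) → F)

/-- The evaluation polynomial `F_I(x) = I_0 g₁(x) + ∑_{i<r} ∑_{1≤j≤ξ(i)} I_{i,j} x^i g(x)^j`. -/
noncomputable def evalPoly (r k : ℕ) (g g₁ : F[X]) (I : Info F r k) : F[X] :=
  C I.1 * g₁ + ∑ i : Fin r, ∑ j : Fin (xi r k i), C (I.2 i j) * X ^ (i : ℕ) * g ^ ((j : ℕ) + 1)

/-- The codeword `(I_0, …, I_0, F_I(a_{i,j}))`, with `δ` copies of `I_0`. -/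
noncomputable def encode (r δ k : ℕ) {L : ℕ} (g g₁ : F[X]) (a : Fin L → Fin (r + δ - 1) → F)
    (I : Info F r k) : Fin δ ⊕ (Fin L × Fin (r + δ - 1)) → F :=
  Sum.elim (fun _ => I.1) (fun p => (evalPoly r k g g₁ I).eval (a p.1 p.2))

/-- The code of Construction B: the set of all codewords `encode I`. -/
noncomputable def constructionB (r δ k : ℕ) {L : ℕ} (g g₁ : F[X])
    (a : Fin L → Fin (r + δ - 1) → F) :
    Submodule F (Fin δ ⊕ (Fin L × Fin (r + δ - 1)) → F) where
  carrier := Set.range (encode r δ k g g₁ a)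
  zero_mem' := by
    refine ⟨0, ?_⟩
    funext p
    rcases p with p | p <;> simp [encode, evalPoly]
  add_mem' := by
    rintro _ _ ⟨I, rfl⟩ ⟨J, rfl⟩
    refine ⟨I + J, ?_⟩
    funext p
    rcases p with p | p
    · simp [encode]
    · simp only [encode, evalPoly, Sum.elim_inr, Pi.add_apply, Prod.fst_add, Prod.snd_add,
        eval_add, eval_mul, eval_C, eval_finsetSum, add_mul, Finset.sum_add_distrib]
      ring
  smul_mem' := by
    rintro c _ ⟨I, rfl⟩
    refine ⟨c • I, ?_⟩
    funext p
    rcases p with p | p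
    · simp [encode]
    · simp only [encode, evalPoly, Sum.elim_inr, Pi.smul_apply, Prod.smul_fst, Prod.smul_snd,
        eval_add, eval_mul, eval_C, eval_finsetSum, smul_eq_mul, mul_add, Finset.mul_sum,
        mul_assoc]

end ConstructionB

end LRC

/-! Three-point fibres of `X ^ 3 + C a * X` are counted through ordered pairs of distinct roots.
Such a pair (x, y) satisfies x² + xy + y² = -a. As q ≡ 2 mod 3, -3 is a nonsquare, so this conic has
q + 1 points (`card_conic`). As a is a nonzero square, the derivative 3x² + a never vanishes, so no
point of the conic is diagonal. Each full fibre accounts for 6 points, hence 6 G(f) = q + 1. The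
blocks cover at most (q + 1) / 2 < q elements, which leaves room for x₀.

On a block g is constant, so F_I restricts to a polynomial of degree at most 1; with the repeated
symbol this gives the locality.

For the distance, write F_I = I₀ g₁ + E g with g = g₂ g₁. If I₀ = 0, only zeros of E count. If I₀ ≠
0, the zeros are those of I₀ + E g₂, of degree at most deg E + 2 (or constant), and the two copies
of I₀ make up for the extra 2 (`le_hammingNorm_encode`). Conversely, in any code with this repair
profile, k - 1 suitable linear conditions kill whole repair groups (`HasRepairProfile.minDist_le`).
The two bounds coincide, which gives both the distance and optimality. -/

namespace LRC

/-! ### Counting the full fibres of the cubic. -/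

section Counting

theorem natDegree_cubic {F : Type*} [Field F] (a : F) : (X ^ 3 + C a * X : F[X]).natDegree = 3 := by
  compute_degree!

variable {F : Type*} [Field F] [Fintype F]

theorem two_ne_zero_of_card (hq : Fintype.card F % 6 = 5) : (2 : F) ≠ 0 := by
  intro h
  have h0 : ((Fintype.card F : ℕ) : F) = 0 := Nat.cast_card_eq_zero F
  obtain ⟨m, hm⟩ : ∃ m, Fintype.card F = 2 * m + 1 := ⟨Fintype.card F / 2, by omega⟩
  rw [hm] at h0
  push_cast at h0
  rw [h] at h0
  simp at h0

theorem three_ne_zero_of_card (hq : Fintype.card F % 6 = 5) : (3 : F) ≠ 0 := by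
  intro h
  have h0 : ((Fintype.card F : ℕ) : F) = 0 := Nat.cast_card_eq_zero F
  obtain ⟨m, hm⟩ : ∃ m, Fintype.card F = 3 * m + 2 := ⟨Fintype.card F / 3, by omega⟩
  rw [hm] at h0
  push_cast at h0
  rw [h] at h0
  exact two_ne_zero_of_card hq (by simpa using h0)

theorem not_isSquare_neg_three (hq : Fintype.card F % 6 = 5) : ¬ IsSquare (-3 : F) := by
  have h2 := two_ne_zero_of_card hq
  have h3 := three_ne_zero_of_card hq
  rintro ⟨w, hw⟩
  obtain ⟨z, hz⟩ : ∃ z : F, 2 * z = w - 1 := ⟨(w - 1) / 2, by field_simp⟩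
  have hw' : w = 2 * z + 1 := by linear_combination -hz
  subst hw'
  have hz2 : z ^ 2 + z + 1 = 0 := by
    have : (2 * 2) * (z ^ 2 + z + 1) = 0 := by linear_combination -hw
    simpa [h2] using this
  have hz3 : z ^ 3 = 1 := by linear_combination (z - 1) * hz2
  have hz0 : z ≠ 0 := by rintro rfl; simp at hz2
  -- A square root of -3 would produce a root z of z² + z + 1. Since q - 1 ≡ 1 mod 3, z³ = 1 and
  -- z^(q-1) = 1 force z = 1, hence 3 = 0.
  obtain ⟨m, hm⟩ : ∃ m, Fintype.card F - 1 = 3 * m + 1 := ⟨(Fintype.card F - 1) / 3, by omega⟩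
  have hpow := FiniteField.pow_card_sub_one_eq_one z hz0
  rw [hm, pow_succ, pow_mul, hz3, one_pow, one_mul] at hpow
  subst hpow
  exact h3 (by linear_combination hz2)

theorem three_mul_sq_add_ne_zero (hq : Fintype.card F % 6 = 5) {a : F} (ha : a ≠ 0)
    (hsq : IsSquare a) (x : F) : 3 * x ^ 2 + a ≠ 0 := by
  obtain ⟨b, rfl⟩ := hsq
  have hb : b ≠ 0 := by rintro rfl; simp at ha
  have h3 := three_ne_zero_of_card hq
  intro h
  refine not_isSquare_neg_three hq ⟨3 * x / b, ?_⟩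
  field_simp
  linear_combination -h

variable [DecidableEq F]

/-- Rescaling y by m / b turns the sum into a Jacobi sum of the quadratic character with itself,
that is, with its inverse. -/
theorem sum_quadraticChar_mul (hF : ringChar F ≠ 2) {m b : F} (hm : m ≠ 0) (hb : b ≠ 0) :
    ∑ y : F, quadraticChar F y * quadraticChar F (m - b * y) = - quadraticChar F (-b) := by
  have hχ := quadraticChar_ne_one hF
  have hJ := jacobiSum_nontrivial_inv hχ
  rw [(quadraticChar_isQuadratic F).inv, jacobiSum] at hJ
  have hmb : m / b ≠ 0 := div_ne_zero hm hb
  rw [← Equiv.sum_comp (Equiv.mulLeft₀ (m / b) hmb)]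
  have h1 : ∀ y : F, quadraticChar F (m / b * y) * quadraticChar F (m - b * (m / b * y)) =
      quadraticChar F (m / b * m) * (quadraticChar F y * quadraticChar F (1 - y)) := by
    intro y
    have : m - b * (m / b * y) = m * (1 - y) := by field_simp
    rw [this]
    simp only [map_mul]
    ring
  simp only [Equiv.mulLeft₀_apply, h1, ← Finset.mul_sum, hJ]
  have h2 : m / b * m = b * (m / b) ^ 2 := by field_simp
  have h3 : -b = b * -1 := by ring
  rw [h2, h3, map_mul, map_mul, map_pow, quadraticChar_sq_one hmb]
  ring

/-- For fixed y, completing the square with u = 2x + y leaves u² = 4c - 3y², with 1 + χ(4c - 3y²)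
solutions. Summing over b = y² with multiplicity 1 + χ(b), the linear character sum vanishes and the
other equals -χ(-3) = 1. -/
theorem card_conic (hq : Fintype.card F % 6 = 5) {c : F} (hc : c ≠ 0) :
    (Finset.univ.filter fun p : F × F => p.1 ^ 2 + p.1 * p.2 + p.2 ^ 2 = c).card =
      Fintype.card F + 1 := by
  have h2 := two_ne_zero_of_card hq
  have h3 := three_ne_zero_of_card hq
  have hF : ringChar F ≠ 2 := by
    intro h
    apply h2
    have := ringChar.Nat.cast_ringChar (R := F)
    rw [h] at this
    exact_mod_cast this
  have hsqrt : ∀ a : F, ((Finset.univ.filter fun x : F => x ^ 2 = a).card : ℤ) =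
      quadraticChar F a + 1 := by
    intro a
    rw [← quadraticChar_card_sqrts hF a]
    congr 2
    ext x
    simp
  have hfib : ∀ y : F, ((Finset.univ.filter fun x : F => x ^ 2 + x * y + y ^ 2 = c).card : ℤ) =
      quadraticChar F (4 * c - 3 * y ^ 2) + 1 := by
    intro y
    rw [← hsqrt]
    congr 1
    refine Finset.card_bij' (fun x _ => 2 * x + y) (fun u _ => (u - y) / 2) ?_ ?_ ?_ ?_
    · intro x hx
      simp only [Finset.mem_filter, Finset.mem_univ, true_and] at hx ⊢
      linear_combination 4 * hx
    · intro u hu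
      simp only [Finset.mem_filter, Finset.mem_univ, true_and] at hu ⊢
      have h4 : (4 : F) ≠ 0 := by
        rw [show (4 : F) = 2 * 2 by norm_num]; exact mul_ne_zero h2 h2
      apply mul_left_cancel₀ h4
      obtain ⟨v, rfl⟩ : ∃ v, u = 2 * v + y := ⟨(u - y) / 2, by field_simp; ring⟩
      have : (2 * v + y - y) / 2 = v := by field_simp; ring
      rw [this]
      linear_combination hu
    · intro x _
      field_simp
      ring
    · intro u _
      field_simp
      ring
  have hsum : ((Finset.univ.filter fun p : F × F =>
      p.1 ^ 2 + p.1 * p.2 + p.2 ^ 2 = c).card : ℤ) =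
      ∑ y : F, (quadraticChar F (4 * c - 3 * y ^ 2) + 1) := by
    rw [Finset.card_filter, Fintype.sum_prod_type_right]
    push_cast
    refine Finset.sum_congr rfl fun y _ => ?_
    rw [← hfib, Finset.card_filter]
    push_cast
    rfl
  have hsq : ∑ y : F, quadraticChar F (4 * c - 3 * y ^ 2) =
      ∑ b : F, (quadraticChar F b + 1) * quadraticChar F (4 * c - 3 * b) := by
    rw [← Finset.sum_fiberwise (s := Finset.univ) (g := fun y : F => y ^ 2)]
    refine Finset.sum_congr rfl fun b _ => ?_
    rw [← hsqrt, Finset.sum_congr rfl (g := fun _ => quadraticChar F (4 * c - 3 * b))]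
    · simp
    · intro y hy
      simp only [Finset.mem_filter, Finset.mem_univ, true_and] at hy
      rw [hy]
  have h4c : 4 * c ≠ 0 := by
    rw [show (4 : F) = 2 * 2 by norm_num]; exact mul_ne_zero (mul_ne_zero h2 h2) hc
  have hlin : ∑ b : F, quadraticChar F (4 * c - 3 * b) = 0 := by
    rw [← quadraticChar_sum_zero hF]
    exact ((Equiv.mulLeft₀ (3 : F) h3).trans (Equiv.subLeft (4 * c))).sum_comp
      (fun x => quadraticChar F x)
  have hneg : quadraticChar F (-3) = -1 :=
    quadraticChar_neg_one_iff_not_isSquare.mpr (not_isSquare_neg_three hq)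
  have : ((Finset.univ.filter fun p : F × F =>
      p.1 ^ 2 + p.1 * p.2 + p.2 ^ 2 = c).card : ℤ) = Fintype.card F + 1 := by
    rw [hsum, Finset.sum_add_distrib, hsq]
    simp only [add_mul, one_mul, Finset.sum_add_distrib]
    rw [sum_quadraticChar_mul hF h4c h3, hlin, hneg]
    simp
    ring
  exact_mod_cast this

/-- The fibres of `x ↦ x ^ 3 + a x`. -/
def cubicFibre (a t : F) : Finset F := Finset.univ.filter fun x => x ^ 3 + a * x + t = 0

theorem mem_cubicFibre {a t x : F} : x ∈ cubicFibre a t ↔ x ^ 3 + a * x + t = 0 := by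
  simp [cubicFibre]

/-- The cubic has no quadratic term, so its roots sum to zero and the third one is -x - y. -/
theorem cubicFibre_eq (a : F) {x y : F} (h : x ^ 2 + x * y + y ^ 2 = -a) :
    cubicFibre a (-(x ^ 3 + a * x)) = {x, y, -x - y} := by
  ext z
  rw [mem_cubicFibre]
  have : z ^ 3 + a * z + -(x ^ 3 + a * x) = (z - x) * (z - y) * (z - (-x - y)) := by
    linear_combination (z - x) * h
  rw [this]
  simp [sub_eq_zero, or_assoc]

theorem card_cubicFibre (hq : Fintype.card F % 6 = 5) {a : F} (ha : a ≠ 0)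
    (hsq : IsSquare a) {x y : F} (h : x ^ 2 + x * y + y ^ 2 = -a) :
    (cubicFibre a (-(x ^ 3 + a * x))).card = 3 := by
  have key := three_mul_sq_add_ne_zero hq ha hsq
  rw [cubicFibre_eq a h, Finset.card_eq_three]
  refine ⟨x, y, -x - y, ?_, ?_, ?_, rfl⟩
  · rintro rfl
    exact key x (by linear_combination h)
  · intro hxy
    have : y = -2 * x := by linear_combination hxy
    subst this
    exact key x (by linear_combination h)
  · intro hxy
    have : x = -2 * y := by linear_combination hxy
    subst this
    exact key y (by linear_combination h)

theorem six_mul_card_filter_cubicFibre (hq : Fintype.card F % 6 = 5) {a : F} (ha : a ≠ 0)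
    (hsq : IsSquare a) :
    6 * (Finset.univ.filter fun t : F => (cubicFibre a t).card = 3).card =
      Fintype.card F + 1 := by
  rw [← card_conic hq (neg_ne_zero.mpr ha)]
  rw [Finset.card_eq_sum_card_fiberwise (f := fun p : F × F => -(p.1 ^ 3 + a * p.1))
    (t := Finset.univ.filter fun t : F => (cubicFibre a t).card = 3)]
  · rw [Finset.sum_const_nat (m := 6), mul_comm]
    intro t ht
    simp only [Finset.mem_filter, Finset.mem_univ, true_and] at ht
    -- The conic points over t are the ordered pairs of distinct elements of the fibre, so there are
    -- 3 · 3 - 3 = 6 of them.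
    have : (Finset.univ.filter fun p : F × F => p.1 ^ 2 + p.1 * p.2 + p.2 ^ 2 = -a).filter
        (fun p => -(p.1 ^ 3 + a * p.1) = t) = (cubicFibre a t).offDiag := by
      ext ⟨x, y⟩
      simp only [Finset.mem_filter, Finset.mem_univ, true_and, Finset.mem_offDiag,
        mem_cubicFibre]
      constructor
      · rintro ⟨h, rfl⟩
        refine ⟨by ring, by linear_combination (y - x) * h, ?_⟩
        rintro rfl
        exact three_mul_sq_add_ne_zero hq ha hsq x (by linear_combination h)
      · rintro ⟨hx, hy, hxy⟩
        refine ⟨?_, by linear_combination -hx⟩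
        apply mul_left_cancel₀ (sub_ne_zero.mpr hxy)
        linear_combination hx - hy
    rw [this, Finset.offDiag_card, ht]
  · intro p hp
    simp only [Finset.coe_filter, Finset.mem_univ, true_and, Set.mem_ofPred_eq] at hp ⊢
    exact card_cubicFibre hq ha hsq hp

theorem card_filter_cubicFibre (hq : Fintype.card F % 6 = 5) {a : F} (ha : a ≠ 0)
    (hsq : IsSquare a) :
    (Finset.univ.filter fun t : F => (cubicFibre a t).card = 3).card =
      (Fintype.card F + 1) / 6 := by
  have := six_mul_card_filter_cubicFibre hq ha hsq
  omega

theorem goodness_cubic (hq : Fintype.card F % 6 = 5) {a : F} (ha : a ≠ 0)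
    (hsq : IsSquare a) : goodness (X ^ 3 + C a * X : F[X]) = (Fintype.card F + 1) / 6 := by
  rw [← card_filter_cubicFibre hq ha hsq, goodness, natDegree_cubic, rootCount,
    ← Set.ncard_coe_finset]
  congr 1
  ext t
  simp only [Set.mem_ofPred_eq, Finset.coe_filter, Finset.mem_univ, true_and]
  rw [← Set.ncard_coe_finset]
  simp [cubicFibre]

theorem exists_isConstantOnBlocks_cubic (hq : Fintype.card F % 6 = 5) {a : F} (ha : a ≠ 0)
    (hsq : IsSquare a) :
    ∃ b : Fin ((Fintype.card F + 1) / 6) → Fin 3 → F,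
      IsConstantOnBlocks (X ^ 3 + C a * X) b := by
  let T := Finset.univ.filter fun t : F => (cubicFibre a t).card = 3
  let e : Fin ((Fintype.card F + 1) / 6) ≃ T :=
    (T.equivFinOfCardEq (card_filter_cubicFibre hq ha hsq)).symm
  have hT : ∀ t : T, (cubicFibre a t).card = 3 := fun t => (Finset.mem_filter.mp t.2).2
  let b : Fin ((Fintype.card F + 1) / 6) → Fin 3 → F := fun i j =>
    ((cubicFibre a (e i)).equivFinOfCardEq (hT (e i))).symm j
  have hb : ∀ i j, (b i j) ^ 3 + a * b i j + e i = 0 := fun i j =>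
    mem_cubicFibre.mp (((cubicFibre a (e i)).equivFinOfCardEq (hT (e i))).symm j).2
  refine ⟨b, fun i => Subtype.val_injective.comp (Equiv.injective _), ?_, ?_⟩
  · intro i i' hii
    rw [Set.disjoint_left]
    rintro _ ⟨j, rfl⟩ ⟨j', h⟩
    apply hii
    apply e.injective
    apply Subtype.ext
    have h1 := hb i j
    have h2 := hb i' j'
    rw [h] at h2
    linear_combination h1 - h2
  · intro i j j'
    simp only [eval_add, eval_pow, eval_X, eval_mul, eval_C]
    linear_combination hb i j - hb i j'

end Counting

/-! ### Upper bound on the distance from the repair groups. -/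

section UpperBound

variable {F : Type*} [Field F] [DecidableEq F] {ι : Type*}

theorem minDist_le_hammingNorm [Fintype ι] {C : Submodule F (ι → F)} {c : ι → F} (hc : c ∈ C) (h0 : c ≠ 0) :
    minDist C ≤ hammingNorm c :=
  Nat.sInf_le ⟨c, hc, h0, rfl⟩

theorem le_minDist [Fintype ι] {C : Submodule F (ι → F)} (hC : C ≠ ⊥) {d : ℕ}
    (h : ∀ c ∈ C, c ≠ 0 → d ≤ hammingNorm c) : d ≤ minDist C := by
  obtain ⟨c, hc, h0⟩ := C.exists_mem_ne_zero_of_ne_bot hC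
  refine le_csInf ⟨_, c, hc, h0, rfl⟩ ?_
  rintro _ ⟨c, hc, h0, rfl⟩
  exact h c hc h0

/-- Local repair groups for `δ = 2`: each coordinate of the group is determined by the others. -/
theorem isRepairGroup_two_iff {r : ℕ} {C : Submodule F (ι → F)} {R : Finset ι} :
    IsRepairGroup r 2 C R ↔ R.card ≤ r + 1 ∧
      ∀ c ∈ C, ∀ j ∈ R, (∀ i ∈ R, i ≠ j → c i = 0) → c j = 0 := by
  refine and_congr Iff.rfl ⟨?_, ?_⟩
  · intro h c hc j hj hz
    by_contra hcj
    have hmem : LinearMap.funLeft F F (Subtype.val : R → ι) c ∈ punctured C R :=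
      Submodule.mem_map_of_mem hc
    have hne : LinearMap.funLeft F F (Subtype.val : R → ι) c ≠ 0 := fun h0 =>
      hcj (congrFun h0 ⟨j, hj⟩)
    rcases h with h | h
    · rw [h, Submodule.mem_bot] at hmem
      exact hne hmem
    · have h1 := h.trans (minDist_le_hammingNorm hmem hne)
      have h2 : hammingNorm (LinearMap.funLeft F F (Subtype.val : R → ι) c) ≤ 1 := by
        rw [← Finset.card_singleton (⟨j, hj⟩ : R)]
        refine Finset.card_le_card fun i hi => ?_
        rw [Finset.mem_filter] at hi
        rw [Finset.mem_singleton]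
        by_contra hij
        exact hi.2 (hz i i.2 fun h => hij (Subtype.ext h))
      omega
  · intro h
    by_cases hb : punctured C R = ⊥
    · exact Or.inl hb
    refine Or.inr (le_minDist hb ?_)
    rintro _ ⟨c, hc, rfl⟩ hne
    by_contra hlt
    have h1 : hammingNorm (LinearMap.funLeft F F (Subtype.val : R → ι) c) ≤ 1 := by omega
    obtain ⟨j, hj⟩ := Function.ne_iff.mp hne
    refine hj (h c hc j j.2 fun i hi hij => ?_)
    by_contra hci
    have := Finset.card_le_one.mp h1 ⟨i, hi⟩
      (Finset.mem_filter.mpr ⟨Finset.mem_univ _, hci⟩) j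
      (Finset.mem_filter.mpr ⟨Finset.mem_univ _, hj⟩)
    exact hij (congrArg Subtype.val this)

variable [Fintype ι]

/-- Fewer than dim C linear conditions leave a nonzero codeword vanishing on T, hence on S. -/
theorem minDist_le_of_forall_eq_zero {C : Submodule F (ι → F)} (S T : Finset ι)
    (hT : T.card < Module.finrank F C)
    (h : ∀ c ∈ C, (∀ i ∈ T, c i = 0) → ∀ i ∈ S, c i = 0) :
    minDist C ≤ Fintype.card ι - S.card := by
  classical
  let φ : C →ₗ[F] (T → F) := (LinearMap.funLeft F F (Subtype.val : T → ι)).comp C.subtype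
  have hφ : φ.ker ≠ ⊥ := LinearMap.ker_ne_bot_of_finrank_lt (by simpa using hT)
  obtain ⟨⟨c, hc⟩, hker, hne⟩ := Submodule.exists_mem_ne_zero_of_ne_bot hφ
  have hS := h c hc fun i hi => congrFun (LinearMap.mem_ker.mp hker) ⟨i, hi⟩
  refine (minDist_le_hammingNorm hc fun h0 => hne (Subtype.ext h0)).trans ?_
  rw [← Finset.card_compl]
  refine Finset.card_le_card fun i hi => ?_
  rw [Finset.mem_filter] at hi
  exact Finset.mem_compl.mpr fun hiS => hi.2 (hS i hiS)

/-- Each group costs one condition less than its size: once all its coordinates but one vanish, the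
last one does too. -/
theorem minDist_le_of_isRepairGroup {κ : Type*} {r : ℕ} {C : Submodule F (ι → F)} (J : Finset κ)
    (A : κ → Finset ι) (hA : ∀ i ∈ J, IsRepairGroup r 2 C (A i))
    (hne : ∀ i, (A i).Nonempty) (hdisj : (J : Set κ).PairwiseDisjoint A)
    (hJ : ∑ i ∈ J, ((A i).card - 1) < Module.finrank F C) :
    minDist C ≤ Fintype.card ι - ∑ i ∈ J, (A i).card := by
  classical
  rw [← Finset.card_biUnion hdisj]
  choose p hp using hne
  refine minDist_le_of_forall_eq_zero _ (J.biUnion fun i => (A i).erase (p i)) ?_ ?_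
  · refine (Finset.card_biUnion_le.trans_eq ?_).trans_lt hJ
    exact Finset.sum_congr rfl fun i hi => Finset.card_erase_of_mem (hp i)
  · intro c hc hz
    have hz' : ∀ i ∈ J, ∀ x ∈ A i, x ≠ p i → c x = 0 := fun i hi x hx hne =>
      hz x (Finset.mem_biUnion.mpr ⟨i, hi, Finset.mem_erase.mpr ⟨hne, hx⟩⟩)
    intro x hx
    obtain ⟨i, hi, hx⟩ := Finset.mem_biUnion.mp hx
    by_cases hxp : x = p i
    · rw [hxp]
      exact (isRepairGroup_two_iff.mp (hA i hi)).2 c hc _ (hp i) (hz' i hi)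
    · exact hz' i hi x hx hxp

/-- The distance bound for `(2, 2)`-locality with disjoint repair groups of sizes `3, …, 3, 2`. -/
theorem HasRepairProfile.minDist_le {L k : ℕ} {C : Submodule F (ι → F)}
    (hC : HasRepairProfile 2 2 L 2 C) (hι : Fintype.card ι = 3 * L + 2)
    (hk : Module.finrank F C = k) (hk2 : 2 ≤ k) (hkL : k ≤ 2 * L + 1) :
    minDist C ≤ 3 * L + 4 - k - (k + 2) / 2 := by
  obtain ⟨A, B, hA, hB, hAA, hAB⟩ := hC
  let G : Option (Fin L) → Finset ι := fun o => o.elim B A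
  have hG : ∀ o, IsRepairGroup 2 2 C (G o) := by
    rintro (_ | i)
    exacts [hB.1, (hA i).1]
  have hne : ∀ o, (G o).Nonempty := by
    rintro (_ | i)
    · exact Finset.card_pos.mp (by rw [show (G none).card = 2 from hB.2]; norm_num)
    · exact Finset.card_pos.mp (by rw [show (G (some i)).card = 3 from (hA i).2]; norm_num)
  have hdisj : ∀ J : Set (Option (Fin L)), J.PairwiseDisjoint G := by
    rintro J (_ | i) - (_ | j) - hij
    · exact absurd rfl hij
    · exact (hAB j).symm
    · exact hAB i
    · exact hAA i j fun h => hij (congrArg some h)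
  have hcardA : ∀ i, (G (some i)).card = 3 := fun i => (hA i).2
  have hcardB : (G none).card = 2 := hB.2
  obtain ⟨J, -, hJ⟩ := Finset.exists_subset_card_eq
    (s := (Finset.univ : Finset (Fin L))) (n := (k - 1) / 2) (by rw [Finset.card_fin]; omega)
  -- Exactly k - 1 conditions are spent. For even k the group of size 2 takes one and (k - 2) / 2
  -- triples take two each; for odd k, (k - 1) / 2 triples suffice.
  rcases Nat.even_or_odd k with ⟨s, hs⟩ | ⟨s, hs⟩
  · have h := minDist_le_of_isRepairGroup (C := C) (Finset.insertNone J) G (fun o _ => hG o)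
      hne (hdisj _)
      (by simp only [Finset.sum_insertNone, hcardA, hcardB, Finset.sum_const, smul_eq_mul]; omega)
    simp only [Finset.sum_insertNone, hcardA, hcardB, Finset.sum_const, smul_eq_mul] at h
    omega
  · have h := minDist_le_of_isRepairGroup (C := C) (J.map Function.Embedding.some) G
      (fun o _ => hG o) hne (hdisj _)
      (by simp only [Finset.sum_map, Function.Embedding.some_apply, hcardA, Finset.sum_const,
            smul_eq_mul]
          omega)
    simp only [Finset.sum_map, Function.Embedding.some_apply, hcardA, Finset.sum_const,
      smul_eq_mul] at h
    omega

end UpperBound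

/-! ### Translation by a constant and the data of Construction B. -/

section GoodPolynomials

variable {F : Type*} [Field F]

theorem goodness_sub_C (f : F[X]) (c : F) : goodness (f - C c) = goodness f := by
  rw [goodness, goodness, natDegree_sub_C, rootCount, rootCount,
    ← Set.ncard_image_of_injective {t : F | {x : F | (f + C t).eval x = 0}.ncard = _}
      (add_left_injective c), Set.image_add_right]
  congr 1
  ext t
  have : f - C c + C t = f + C (t + -c) := by
    rw [C_add, C_neg]
    ring
  simp only [Set.mem_ofPred_eq, Set.mem_preimage, this]

theorem IsConstantOnBlocks.sub_C {L m : ℕ} {f : F[X]} {a : Fin L → Fin m → F}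
    (h : IsConstantOnBlocks f a) (c : F) : IsConstantOnBlocks (f - C c) a :=
  ⟨h.1, h.2.1, fun i j j' => by rw [eval_sub, eval_sub, h.2.2 i j j', eval_C, eval_C]⟩

theorem IsConstantOnBlocks.injective_uncurry {L m : ℕ} {f : F[X]} {a : Fin L → Fin m → F}
    (h : IsConstantOnBlocks f a) : Function.Injective fun p : Fin L × Fin m => a p.1 p.2 := by
  rintro ⟨i, j⟩ ⟨i', j'⟩ hp
  have hi : i = i' := by
    by_contra hi
    exact Set.disjoint_left.mp (h.2.1 i i' hi) ⟨j, rfl⟩ ⟨j', hp.symm⟩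
  subst hi
  exact congrArg (Prod.mk i) (h.1 i hp)

/-- A block already supplies m = deg f solutions of f = const, so no point outside it can share its
value. -/
theorem IsConstantOnBlocks.eval_ne_eval {L m : ℕ} {f : F[X]} {a : Fin L → Fin m → F}
    (h : IsConstantOnBlocks f a) (hm : f.natDegree = m) (hm0 : 0 < m) {x : F}
    (hx : ∀ i j, a i j ≠ x) (i : Fin L) (j : Fin m) : f.eval (a i j) ≠ f.eval x := by
  classical
  intro hij
  have hdeg : (f - C (f.eval x)).natDegree = m := by rw [natDegree_sub_C, hm]
  have hne : f - C (f.eval x) ≠ 0 := by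
    intro h0
    rw [h0, natDegree_zero] at hdeg
    omega
  have hsub : insert x (Finset.univ.image (a i)) ⊆ (f - C (f.eval x)).roots.toFinset := by
    intro y hy
    rw [Multiset.mem_toFinset, mem_roots hne, IsRoot.def, eval_sub, eval_C, sub_eq_zero]
    rcases Finset.mem_insert.mp hy with rfl | hy
    · rfl
    · obtain ⟨j', -, rfl⟩ := Finset.mem_image.mp hy
      rw [h.2.2 i j' j, hij]
  have hcard := Finset.card_le_card hsub
  rw [Finset.card_insert_of_notMem, Finset.card_image_of_injective _ (h.1 i), Finset.card_fin]
    at hcard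
  · have := (Multiset.toFinset_card_le _).trans (card_roots' (f - C (f.eval x)))
    omega
  · intro hmem
    obtain ⟨j', -, hj'⟩ := Finset.mem_image.mp hmem
    exact hx i j' hj'

theorem exists_forall_block_ne {F : Type*} [Fintype F] {L m : ℕ} (a : Fin L → Fin m → F)
    (hL : L * m < Fintype.card F) :
    ∃ x, ∀ i j, a i j ≠ x := by
  by_contra! hx
  have hsurj : Function.Surjective fun p : Fin L × Fin m => a p.1 p.2 := fun x => by
    obtain ⟨i, j, hij⟩ := hx x
    exact ⟨(i, j), hij⟩
  have := Fintype.card_le_of_surjective _ hsurj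
  simp at this
  omega

theorem isConstructionBData_cubic {L : ℕ} (hL : 1 ≤ L) {f : F[X]} (hf : f.natDegree = 3)
    {a : Fin L → Fin 3 → F} (ha : IsConstantOnBlocks f a) {x₀ : F} (hx₀ : ∀ i j, a i j ≠ x₀) :
    IsConstructionBData 2 2 (f - C (f.eval x₀)) (X - C x₀)
      ((f - C (f.eval x₀)) / (X - C x₀)) a := by
  have hdeg : (f - C (f.eval x₀)).natDegree = 3 := by rw [natDegree_sub_C, hf]
  have hmul : (X - C x₀) * ((f - C (f.eval x₀)) / (X - C x₀)) = f - C (f.eval x₀) := by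
    rw [mul_div_eq_iff_isRoot, IsRoot.def, eval_sub, eval_C, sub_self]
  have hg := ha.sub_C (f.eval x₀)
  refine ⟨⟨by omega, L, ?_⟩, by rw [mul_comm, hmul], hdeg, natDegree_X_sub_C x₀, ?_, hg, ?_⟩
  · rw [hdeg]
    exact ⟨a, hL, hg⟩
  · have h0 : (f - C (f.eval x₀)) / (X - C x₀) ≠ 0 := by
      intro h0
      rw [h0, mul_zero] at hmul
      rw [← hmul, natDegree_zero] at hdeg
      omega
    have := natDegree_mul (X_sub_C_ne_zero x₀) h0
    rw [hmul, hdeg, natDegree_X_sub_C] at this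
    omega
  · intro i j
    rw [eval_sub, eval_C, sub_ne_zero]
    exact ha.eval_ne_eval hf (by norm_num) hx₀ i j

end GoodPolynomials

/-! ### Hamming weights and roots of polynomials. -/

section Weights

variable {F : Type*} [Field F] [DecidableEq F]

theorem hammingNorm_sumElim {α β : Type*} [Fintype α] [Fintype β] (u : α → F) (v : β → F) :
    hammingNorm (Sum.elim u v) = hammingNorm u + hammingNorm v := by
  simp only [hammingNorm, Finset.card_filter, Fintype.sum_sum_type]
  rfl

theorem card_le_hammingNorm_eval_add_natDegree {κ : Type*} [Fintype κ] {a : κ → F}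
    (ha : Function.Injective a) {P : F[X]} (hP : P ≠ 0) :
    Fintype.card κ ≤ hammingNorm (fun p => P.eval (a p)) + P.natDegree := by
  rw [hammingNorm, ← Finset.card_univ, ← Finset.card_filter_add_card_filter_not
    (s := Finset.univ) (fun p => P.eval (a p) ≠ 0)]
  gcongr
  rw [← Finset.card_image_of_injective _ ha]
  refine (Finset.card_le_card fun y hy => ?_).trans
    ((Multiset.toFinset_card_le _).trans (card_roots' P))
  obtain ⟨p, hp, rfl⟩ := Finset.mem_image.mp hy
  rw [Multiset.mem_toFinset, mem_roots hP]
  simpa using hp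

end Weights

/-! ### Dimension, distance and locality of the code. -/

section ConstructionB

variable {F : Type*} [Field F]

theorem sum_C_mul_X_pow_eq_zero {n : ℕ} {v : Fin n → F}
    (h : ∑ j : Fin n, C (v j) * X ^ (j : ℕ) = (0 : F[X])) : v = 0 := by
  funext j
  have := congrArg (fun p => coeff p (j : ℕ)) h
  simpa [finsetSum_coeff, coeff_C_mul, coeff_X_pow, Fin.val_inj] using this

/-- The cofactor of `g` in `evalPoly`. -/
noncomputable def cofactor (r k : ℕ) (g : F[X]) (v : (i : Fin r) → Fin (xi r k i) → F) : F[X] :=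
  ∑ i : Fin r, ∑ j : Fin (xi r k i), C (v i j) * X ^ (i : ℕ) * g ^ (j : ℕ)

theorem evalPoly_eq (r k : ℕ) (g g₁ : F[X]) (I : Info F r k) :
    evalPoly r k g g₁ I = C I.1 * g₁ + cofactor r k g I.2 * g := by
  simp only [evalPoly, cofactor, Finset.sum_mul, pow_succ, mul_assoc]

theorem natDegree_cofactor_le {r k M : ℕ} {g : F[X]} {v : (i : Fin r) → Fin (xi r k i) → F}
    (hM : ∀ (i : Fin r) (j : Fin (xi r k i)), (i : ℕ) + j * g.natDegree ≤ M) :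
    (cofactor r k g v).natDegree ≤ M := by
  refine natDegree_sum_le_of_forall_le _ _ fun i _ => natDegree_sum_le_of_forall_le _ _ fun j _ => ?_
  refine natDegree_mul_le.trans (le_trans ?_ (hM i j))
  exact add_le_add (natDegree_C_mul_X_pow_le _ _) natDegree_pow_le

theorem cofactor_two_eq_zero {k : ℕ} {g : F[X]} (hg : 2 ≤ g.natDegree)
    {v : (i : Fin 2) → Fin (xi 2 k i) → F} (h : cofactor 2 k g v = 0) : v = 0 := by
  let P : Fin 2 → F[X] := fun i => ∑ j : Fin (xi 2 k i), C (v i j) * X ^ (j : ℕ)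
  have hP : (P 0).comp g + X * (P 1).comp g = 0 := by
    rw [← h, cofactor, Fin.sum_univ_two]
    simp only [P, Polynomial.sum_comp, mul_comp, C_comp, X_pow_comp, Finset.mul_sum]
    congr 1
    · simp
    · refine Finset.sum_congr rfl fun j _ => ?_
      simp
      ring
  have hcomp : ∀ Q : F[X], Q.comp g = 0 → Q = 0 := by
    intro Q hQ
    rcases comp_eq_zero_iff.mp hQ with h | ⟨-, h⟩
    · exact h
    · rw [h, natDegree_C] at hg
      omega
  have hP1 : P 1 = 0 := by
    by_contra h1
    have h1' : (P 1).comp g ≠ 0 := fun h => h1 (hcomp _ h)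
    have hd := congrArg natDegree (eq_neg_of_add_eq_zero_left hP)
    rw [natDegree_neg, natDegree_X_mul h1', natDegree_comp, natDegree_comp] at hd
    -- The degree of P₀(g) is 0 modulo deg g, while that of X P₁(g) is 1, so they cannot cancel.
    have h2 := congrArg (· % g.natDegree) hd
    simp only [Nat.mul_mod_left, Nat.mul_add_mod_self_right] at h2
    rw [Nat.mod_eq_of_lt (by omega)] at h2
    omega
  have hP0 : P 0 = 0 := by
    rw [hP1, zero_comp, mul_zero, add_zero] at hP
    exact hcomp _ hP
  funext i
  fin_cases i
  · exact sum_C_mul_X_pow_eq_zero hP0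
  · exact sum_C_mul_X_pow_eq_zero hP1

variable {L : ℕ} {g g₁ g₂ : F[X]} {a : Fin L → Fin 3 → F}

theorem le_hammingNorm_encode [DecidableEq F] (hd : IsConstructionBData 2 2 g g₁ g₂ a) {k M : ℕ}
    (hM : ∀ (i : Fin 2) (j : Fin (xi 2 k i)), (i : ℕ) + j * 3 ≤ M) {I : Info F 2 k} (hI : I ≠ 0) :
    3 * L ≤ hammingNorm (encode 2 2 k g g₁ a I) + M := by
  obtain ⟨-, hg, hg3, hg1, hg2, ha, hne⟩ := hd
  have hg3 : g.natDegree = 3 := hg3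
  have hE := natDegree_cofactor_le (r := 2) (v := I.2) (g := g) (by rwa [hg3])
  have hinj : Function.Injective fun p : Fin L × Fin 3 => a p.1 p.2 := ha.injective_uncurry
  have hcard : Fintype.card (Fin L × Fin 3) = 3 * L := by simp [mul_comm]
  have hnorm : ∀ P : F[X], (∀ i j, P.eval (a i j) = 0 ↔
      (evalPoly 2 k g g₁ I).eval (a i j) = 0) →
      hammingNorm (encode 2 2 k g g₁ a I) =
        hammingNorm (fun _ : Fin 2 => I.1) + hammingNorm fun p : Fin L × Fin 3 =>
          P.eval (a p.1 p.2) := by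
    intro P hP
    rw [encode, hammingNorm_sumElim]
    congr 1
    simp only [hammingNorm, ne_eq, hP]
  by_cases hI0 : I.1 = 0
  · have hE0 : cofactor 2 k g I.2 ≠ 0 := fun h =>
      hI (Prod.ext hI0 (cofactor_two_eq_zero (by omega) h))
    have h1 := card_le_hammingNorm_eval_add_natDegree hinj hE0
    -- Here F_I = E g, and g has no zero on the blocks, so E and F_I vanish at the same block
    -- points.
    rw [hnorm (cofactor 2 k g I.2) fun i j => by simp [evalPoly_eq, hI0, hne i j]]
    omega
  · have hg10 : ∀ i j, g₁.eval (a i j) ≠ 0 := by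
      intro i j h
      apply hne i j
      rw [hg, eval_mul, h, mul_zero]
    -- Otherwise E g₂ would be a nonzero constant, although deg g₂ = 2.
    have hQ0 : C I.1 + cofactor 2 k g I.2 * g₂ ≠ 0 := by
      intro h
      have h' : cofactor 2 k g I.2 * g₂ = C (-I.1) := by
        rw [C_neg]; exact eq_neg_of_add_eq_zero_right h
      have hne0 : cofactor 2 k g I.2 * g₂ ≠ 0 := by
        rw [h']; simpa using hI0
      have hdeg := natDegree_mul (left_ne_zero_of_mul hne0) (right_ne_zero_of_mul hne0)
      rw [h', natDegree_C] at hdeg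
      omega
    have hQ : (C I.1 + cofactor 2 k g I.2 * g₂).natDegree ≤ M + 2 := by
      refine (natDegree_add_le _ _).trans (max_le (by simp) ?_)
      exact natDegree_mul_le.trans (by omega)
    have h1 := card_le_hammingNorm_eval_add_natDegree hinj hQ0
    have h2 : hammingNorm (fun _ : Fin 2 => I.1) = 2 := by simp [hammingNorm, hI0]
    rw [hnorm (C I.1 + cofactor 2 k g I.2 * g₂) fun i j => ?_, h2]
    · omega
    · have : evalPoly 2 k g g₁ I = (C I.1 + cofactor 2 k g I.2 * g₂) * g₁ := by
        rw [evalPoly_eq]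
        nth_rewrite 2 [hg]
        ring
      rw [this, eval_mul, mul_eq_zero, or_iff_left (hg10 i j)]

/-- The encoding map of Construction B as a linear map. -/
noncomputable def encodeLinear (r δ k : ℕ) {L : ℕ} (g g₁ : F[X])
    (a : Fin L → Fin (r + δ - 1) → F) :
    Info F r k →ₗ[F] (Fin δ ⊕ (Fin L × Fin (r + δ - 1)) → F) where
  toFun := encode r δ k g g₁ a
  map_add' I J := by
    funext p
    rcases p with p | p
    · simp [encode]
    · simp only [encode, evalPoly, Sum.elim_inr, Pi.add_apply, Prod.fst_add, Prod.snd_add,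
        eval_add, eval_mul, eval_C, eval_finsetSum, add_mul, Finset.sum_add_distrib]
      ring
  map_smul' c I := by
    funext p
    rcases p with p | p
    · simp [encode]
    · simp only [encode, evalPoly, Sum.elim_inr, Pi.smul_apply, Prod.smul_fst, Prod.smul_snd,
        eval_add, eval_mul, eval_C, eval_finsetSum, smul_eq_mul, mul_add, Finset.mul_sum,
        mul_assoc, RingHom.id_apply]

theorem constructionB_eq_range (r δ k : ℕ) {L : ℕ} (g g₁ : F[X])
    (a : Fin L → Fin (r + δ - 1) → F) :
    constructionB r δ k g g₁ a = (encodeLinear r δ k g g₁ a).range :=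
  SetLike.coe_injective rfl

/-- M is the largest exponent i + 3j in the cofactor, reached at i = 0 for even k and at i = 1 for
odd k. For k ≥ 2 the subtraction does not truncate. -/
theorem xi_two_bound {k M : ℕ} (hk : 2 ≤ k) (hM : M = k + (k + 2) / 2 - 4) (i : Fin 2)
    (j : Fin (xi 2 k i)) : (i : ℕ) + j * 3 ≤ M := by
  have hj := j.2
  have hi := i.2
  unfold xi at hj
  split_ifs at hj <;> omega

theorem finrank_info {k : ℕ} (hk : 2 ≤ k) : Module.finrank F (Info F 2 k) = k := by
  rw [Module.finrank_prod, Module.finrank_self, Module.finrank_pi_fintype, Fin.sum_univ_two]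
  rw [Module.finrank_fin_fun, Module.finrank_fin_fun]
  simp only [xi, Fin.val_zero, Fin.val_one]
  split_ifs <;> omega

theorem finrank_constructionB (hd : IsConstructionBData 2 2 g g₁ g₂ a) {k : ℕ} (hk : 2 ≤ k)
    (hkL : k ≤ 2 * L + 1) : Module.finrank F (constructionB 2 2 k g g₁ a) = k := by
  classical
  rw [constructionB_eq_range, LinearMap.finrank_range_of_inj, finrank_info hk]
  rw [← LinearMap.ker_eq_bot, LinearMap.ker_eq_bot']
  intro I hI
  by_contra hne
  -- For k ≤ 2L + 1 the degree bound is below 3L, so a nonzero information vector has positive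
  -- weight and encoding is injective.
  have h := le_hammingNorm_encode hd (xi_two_bound hk rfl) hne
  rw [show encode 2 2 k g g₁ a I = 0 from hI, hammingNorm_zero] at h
  omega

theorem le_minDist_constructionB [DecidableEq F] (hd : IsConstructionBData 2 2 g g₁ g₂ a) {k : ℕ}
    (hk : 2 ≤ k) (hkL : k ≤ 2 * L + 1) :
    3 * L + 4 - k - (k + 2) / 2 ≤ minDist (constructionB 2 2 k g g₁ a) := by
  refine le_minDist ?_ ?_
  · intro h
    have := finrank_constructionB hd hk hkL
    rw [h, finrank_bot] at this
    omega
  · rintro _ ⟨I, rfl⟩ hne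
    have hI : I ≠ 0 := by
      rintro rfl
      exact hne (map_zero (encodeLinear 2 2 k g g₁ a))
    have := le_hammingNorm_encode hd (xi_two_bound hk rfl) hI
    omega

/-- On a block the powers of g are scalars, so only the terms in 1 and x remain. -/
theorem exists_encode_inr_eq (k : ℕ) (x₀ : F) {i : Fin L}
    (ha : ∀ j j', g.eval (a i j) = g.eval (a i j')) (I : Info F 2 k) :
    ∃ u v : F, ∀ j, encode 2 2 k g (X - C x₀) a I (Sum.inr (i, j)) = u * a i j + v := by
  refine ⟨I.1 + ∑ j : Fin (xi 2 k (1 : Fin 2)), I.2 1 j * g.eval (a i 0) ^ ((j : ℕ) + 1),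
    -(I.1 * x₀) + ∑ j : Fin (xi 2 k (0 : Fin 2)), I.2 0 j * g.eval (a i 0) ^ ((j : ℕ) + 1), ?_⟩
  intro j
  simp only [encode, Sum.elim_inr, evalPoly, Fin.sum_univ_two, eval_add, eval_mul, eval_C,
    eval_sub, eval_X, eval_finsetSum, eval_pow, ha j 0, add_mul, Finset.sum_mul]
  have : ∀ n : Fin (xi 2 k (1 : Fin 2)),
      I.2 1 n * a i j ^ ((1 : Fin 2) : ℕ) * eval (a i 0) g ^ ((n : ℕ) + 1) =
      I.2 1 n * eval (a i 0) g ^ ((n : ℕ) + 1) * a i j := fun n => by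
    simp; ring
  simp only [this]
  simp
  ring

theorem isRepairGroup_inl [DecidableEq F] (k : ℕ) :
    IsRepairGroup 2 2 (constructionB 2 2 k g g₁ a)
      (Finset.univ.map (Function.Embedding.inl : Fin 2 ↪ Fin 2 ⊕ (Fin L × Fin 3))) := by
  rw [isRepairGroup_two_iff]
  refine ⟨by simp, ?_⟩
  rintro _ ⟨I, rfl⟩ _ hj hz
  obtain ⟨j, -, rfl⟩ := Finset.mem_map.mp hj
  -- In `Fin 2`, j + 1 is the other coordinate, which carries the same symbol I₀.
  exact hz (Sum.inl (j + 1)) (by simp) (by simp)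

theorem isRepairGroup_inr [DecidableEq F] (ha : IsConstantOnBlocks g a) (k : ℕ) (x₀ : F)
    (i : Fin L) :
    IsRepairGroup 2 2 (constructionB 2 2 k g (X - C x₀) a)
      (Finset.univ.map ((Function.Embedding.sectR i (Fin 3)).trans
        (Function.Embedding.inr : _ ↪ Fin 2 ⊕ (Fin L × Fin 3)))) := by
  rw [isRepairGroup_two_iff]
  refine ⟨by simp, ?_⟩
  rintro _ ⟨I, rfl⟩ _ hj hz
  obtain ⟨j, -, rfl⟩ := Finset.mem_map.mp hj
  obtain ⟨u, v, huv⟩ := exists_encode_inr_eq k x₀ (ha.2.2 i) I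
  obtain ⟨j₁, j₂, h1, h2, h12⟩ : ∃ j₁ j₂ : Fin 3, j₁ ≠ j ∧ j₂ ≠ j ∧ j₁ ≠ j₂ :=
    (by decide : ∀ j : Fin 3, ∃ j₁ j₂ : Fin 3, j₁ ≠ j ∧ j₂ ≠ j ∧ j₁ ≠ j₂) j
  have e1 := huv j₁ ▸ hz (Sum.inr (i, j₁)) (by simp) (by simpa using h1)
  have e2 := huv j₂ ▸ hz (Sum.inr (i, j₂)) (by simp) (by simpa using h2)
  -- A polynomial of degree at most 1 with two distinct zeros is zero.
  have hu : u = 0 := by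
    have : u * (a i j₁ - a i j₂) = 0 := by linear_combination e1 - e2
    exact (mul_eq_zero.mp this).resolve_right (sub_ne_zero.mpr fun h => h12 (ha.1 i h))
  have hv : v = 0 := by simpa [hu] using e1
  exact (huv j).trans (by simp [hu, hv])

theorem isLRC_constructionB [DecidableEq F] (ha : IsConstantOnBlocks g a) (k : ℕ) (x₀ : F) :
    IsLRC 2 2 (constructionB 2 2 k g (X - C x₀) a) := by
  rintro (j | ⟨i, j⟩)
  · exact ⟨_, by simp, isRepairGroup_inl k⟩
  · exact ⟨_, by simp, isRepairGroup_inr ha k x₀ i⟩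

theorem hasRepairProfile_constructionB [DecidableEq F] (ha : IsConstantOnBlocks g a) (k : ℕ)
    (x₀ : F) : HasRepairProfile 2 2 L 2 (constructionB 2 2 k g (X - C x₀) a) := by
  refine ⟨_, _, fun i => ⟨isRepairGroup_inr ha k x₀ i, by simp⟩, ⟨isRepairGroup_inl k, by simp⟩,
    ?_, ?_⟩
  · intro i i' hii
    rw [Finset.disjoint_left]
    rintro _ hj hj'
    obtain ⟨j, -, rfl⟩ := Finset.mem_map.mp hj
    obtain ⟨j', -, h⟩ := Finset.mem_map.mp hj'
    simp at h
    exact hii h.1.symm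
  · intro i
    rw [Finset.disjoint_left]
    rintro _ hj hj'
    obtain ⟨j, -, rfl⟩ := Finset.mem_map.mp hj
    obtain ⟨j', -, h⟩ := Finset.mem_map.mp hj'
    simp at h

theorem minDist_constructionB [DecidableEq F] {x₀ : F}
    (hd : IsConstructionBData 2 2 g (X - C x₀) g₂ a) {k : ℕ}
    (hk : 2 ≤ k) (hkL : k ≤ 2 * L + 1) :
    minDist (constructionB 2 2 k g (X - C x₀) a) = 3 * L + 4 - k - (k + 2) / 2 :=
  le_antisymm ((hasRepairProfile_constructionB hd.2.2.2.2.2.1 k x₀).minDist_le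
    (by simp; omega) (finrank_constructionB hd hk hkL) hk hkL) (le_minDist_constructionB hd hk hkL)

theorem isDistanceOptimal_constructionB [DecidableEq F] {x₀ : F}
    (hd : IsConstructionBData 2 2 g (X - C x₀) g₂ a) {k : ℕ}
    (hk : 2 ≤ k) (hkL : k ≤ 2 * L + 1) :
    IsDistanceOptimal 2 2 L 2 (constructionB 2 2 k g (X - C x₀) a) := by
  refine ⟨isLRC_constructionB hd.2.2.2.2.2.1 k x₀,
    hasRepairProfile_constructionB hd.2.2.2.2.2.1 k x₀, fun C' hfin _ hprof => ?_⟩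
  rw [minDist_constructionB hd hk hkL]
  exact hprof.minDist_le (by simp; omega) (hfin.trans (finrank_constructionB hd hk hkL)) hk hkL

end ConstructionB

/-! ### The ceiling in the distance formula and the final assembly. -/

theorem ceil_succ_div_two (k : ℕ) : ⌈((k : ℚ) + 1) / 2⌉ = (((k + 2) / 2 : ℕ) : ℤ) := by
  rw [Int.ceil_eq_iff]
  rcases Nat.even_or_odd' k with ⟨s, rfl | rfl⟩
  · rw [show (2 * s + 2) / 2 = s + 1 by omega]
    push_cast
    constructor <;> linarith
  · rw [show (2 * s + 1 + 2) / 2 = s + 1 by omega]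
    push_cast
    constructor <;> linarith

end LRC

theorem mainTheorem7 {F : Type*} [Field F] [Fintype F] [DecidableEq F] (q : ℕ)
    (hF : Fintype.card F = q) (hq : q % 6 = 5) :
    (∃ a₁ : F, a₁ ≠ 0 ∧ IsSquare a₁) ∧
    ∀ a₁ : F, a₁ ≠ 0 → IsSquare a₁ →
      ∀ f : F[X], f = X ^ 3 + C a₁ * X →
        LRC.goodness f = (q + 1) / 6 ∧
        (∃ a : Fin ((q + 1) / 6) → Fin 3 → F, LRC.IsConstantOnBlocks f a) ∧
        ∀ a : Fin ((q + 1) / 6) → Fin 3 → F, LRC.IsConstantOnBlocks f a →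
          (∃ x₀ : F, ∀ i j, a i j ≠ x₀) ∧
          ∀ x₀ : F, (∀ i j, a i j ≠ x₀) →
            ∀ g : F[X], g = f - C (f.eval x₀) →
              LRC.goodness g = LRC.goodness f ∧
              LRC.IsConstructionBData 2 2 g (X - C x₀) (g / (X - C x₀)) a ∧
              Fintype.card (Fin 2 ⊕ (Fin ((q + 1) / 6) × Fin 3)) = (q + 1) / 2 + 2 ∧
              ∀ k : ℕ, 2 ≤ k → k ≤ (q + 1) / 3 + 1 →
                Module.finrank F (LRC.constructionB 2 2 k g (X - C x₀) a) = k ∧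
                ((LRC.minDist (LRC.constructionB 2 2 k g (X - C x₀) a) : ℕ) : ℤ) =
                  (((q + 1) / 2 + 2 : ℕ) : ℤ) - k - ⌈((k : ℚ) + 1) / 2⌉ + 2 ∧
                LRC.IsDistanceOptimal 2 2 ((q + 1) / 6) 2
                  (LRC.constructionB 2 2 k g (X - C x₀) a) := by
  refine ⟨⟨1, one_ne_zero, IsSquare.one⟩, ?_⟩
  rintro a₁ ha₁ hsq f rfl
  subst hF
  refine ⟨LRC.goodness_cubic hq ha₁ hsq, LRC.exists_isConstantOnBlocks_cubic hq ha₁ hsq, ?_⟩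
  intro a ha
  refine ⟨LRC.exists_forall_block_ne a (by omega), ?_⟩
  rintro x₀ hx₀ g rfl
  have hd := LRC.isConstructionBData_cubic (by omega) (LRC.natDegree_cubic a₁) ha hx₀
  refine ⟨LRC.goodness_sub_C _ _, hd, by simp; omega, fun k hk hkL => ?_⟩
  have hkL' : k ≤ 2 * ((Fintype.card F + 1) / 6) + 1 := by omega
  refine ⟨LRC.finrank_constructionB hd hk hkL', ?_, LRC.isDistanceOptimal_constructionB hd hk hkL'⟩
  rw [LRC.minDist_constructionB hd hk hkL', LRC.ceil_succ_div_two]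
  omega
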